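/- Let $G$ and $H$ be separable real Hilbert spaces and $(\Omega,\mathcal F,P)$ a probability space; $L^0_P(\Omega;\mathbb R)$ denotes the space of $P$-almost sure equivalence classes of real random variables with the topology of convergence in probability. Let $(L(t))_{t\ge 0}$ be a cylindrical Lévy process on $G$, that is, each $L(t)\colon G\to L^0_P(\Omega;\mathbb R)$ is linear and continuous, and for all $g_1,\dots,g_m\in G$ the process $\big((L(t)g_1,\dots,L(t)g_m)\big)_{t\ge 0}$ is a Lévy process in $\mathbb R^m$ (it starts at $0$ almost surely, has independent and stationary increments, and is stochastically continuous). Let $\mathcal F_t=\sigma(L(s)g: g\in G,\ 0\le s\le t)$, the $\sigma$-algebra generated by all random variables representing the classes $L(s)g$. On $(\Omega\times\Omega,\mathcal F\otimes\mathcal F,P\otimes P)$ define $(\widetilde L(t)g)(\omega,\omega')=(L(t)g)(\omega')$ for $t\ge 0$, $g\in G$. Then $(\widetilde L(t))_{t\ge0}$ is a cylindrical Lévy process on $G$. Moreover, let $0=t_0\le t_1\le\dots\le t_N=T$ and, for $n=1,\dots,N$, let $\Theta_n=\sum_{k=1}^{M(n)}\Phi_{n,k}\mathbf 1_{A_{n,k}}$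 with Hilbert–Schmidt operators $\Phi_{n,k}\colon G\to H$ and $A_{n,k}\in\mathcal F_{t_{n-1}}$. For each $n,k$ there is a Radonified increment $R_{n,k}=\Phi_{n,k}(L(t_n)-L(t_{n-1}))$, i.e. an $H$-valued random variable on $\Omega$ with $(L(t_n)-L(t_{n-1}))(\Phi_{n,k}^*h)=\langle R_{n,k},h\rangle$ $P$-a.s. for every $h\in H$. For every choice of such $R_{n,k}$, the $H$-valued random variables on $\Omega\times\Omega$ that are Radonified increments $\Phi_{n,k}(\widetilde L(t_n)-\widetilde L(t_{n-1}))$ (defined in the same way) are exactly those that agree $P\otimes P$-a.s. with $(\omega,\omega')\mapsto R_{n,k}(\omega')$, and the sequence $$Y_n(\omega,\omega')=\big(\Theta_n(\widetilde L(t_n)-\widetilde L(t_{n-1}))\big)(\omega,\omega')=\sum_{k=1}^{M(n)}\mathbf 1_{A_{n,k}}(\omega)\,R_{n,k}(\omega'),\qquad n=1,\dots,N,$$ is a decoupled tangent sequence to $$X_n(\omega)=\big(\Theta_n(L(t_n)-L(t_{n-1}))\big)(\omega)=\sum_{k=1}^{M(n)}\mathbf 1_{A_{n,k}}(\omega)\,R_{n,k}(\omega),\qquad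 n=1,\dots,N.$$ That is: each $X_n$ is $\mathcal F_{t_n}$-measurable and each $Y_n$ is $\mathcal F_{t_n}\otimes\mathcal F_{t_n}$-measurable; for every $\omega\in\Omega$ the random variables $Y_1(\omega,\cdot),\dots,Y_N(\omega,\cdot)$ are independent under $P$; and for every $n=1,\dots,N$, writing $X_n(\omega,\omega')=X_n(\omega)$, the regular conditional distributions satisfy $$\mathcal L\big(X_n\mid\mathcal F_{t_{n-1}}\otimes\mathcal F_{t_{n-1}}\big)=\mathcal L\big(Y_n\mid\mathcal F_{t_{n-1}}\otimes\mathcal F_{t_{n-1}}\big)\qquad P\otimes P\text{-a.s.}$$ -/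

import Mathlib

open MeasureTheory ProbabilityTheory Filter Topology
open scoped NNReal ENNReal

namespace CylLevy

section LevyProcess

variable {Ω E : Type*} [MeasurableSpace Ω] [NormedAddCommGroup E] [MeasurableSpace E]

/-- A Lévy process with respect to the probability measure `P`: random variables `X t`, `t ≥ 0`,
with `X 0 = 0` almost surely, independent and stationary increments, and stochastic continuity.
All the conditions only depend on the almost sure equivalence classes of the `X t`; path
regularity is a matter of choosing a modification and is not part of the definition. -/
structure IsLevyProcess (P : Measure Ω) (X : ℝ≥0 → Ω → E) : Prop where
  aemeasurable : ∀ t, AEMeasurable (X t) P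
  zero : X 0 =ᵐ[P] 0
  indepIncrements : HasIndepIncrements X P
  stationaryIncrements : ∀ s h, IdentDistrib (fun ω => X (s + h) ω - X s ω) (X h) P P
  stochasticContinuity : ∀ t, TendstoInMeasure P X (𝓝 t) (X t)

end LevyProcess

section Cylindrical

variable {G H Ω : Type*} [MeasurableSpace Ω]
  [NormedAddCommGroup G] [InnerProductSpace ℝ G]
  [NormedAddCommGroup H] [InnerProductSpace ℝ H]

/-- A cylindrical random variable in `G`: a linear map `X : G → L⁰(Ω; ℝ)` which is continuous for
the topology of convergence in probability. Here `Ω →ₘ[P] ℝ` is the space of almost sure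
equivalence classes of real random variables. -/
def IsCylindricalRV (P : Measure Ω) (X : G →ₗ[ℝ] (Ω →ₘ[P] ℝ)) : Prop :=
  ∀ g : G, TendstoInMeasure P (fun g' : G => (X g' : Ω → ℝ)) (𝓝 g) (X g)

/-- A cylindrical Lévy process in `G`: a family of cylindrical random variables `L t`, `t ≥ 0`,
such that `(L t g₁, …, L t gₙ)`, `t ≥ 0`, is a Lévy process in `ℝⁿ` for all `g₁, …, gₙ ∈ G`. -/
structure IsCylindricalLevyProcess (P : Measure Ω) (L : ℝ≥0 → G →ₗ[ℝ] (Ω →ₘ[P] ℝ)) : Prop where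
  isCylindricalRV : ∀ t, IsCylindricalRV P (L t)
  isLevyProcess : ∀ (n : ℕ) (g : Fin n → G),
    IsLevyProcess P (fun (t : ℝ≥0) (ω : Ω) (i : Fin n) => (L t (g i) : Ω → ℝ) ω)

/-- The filtration generated by a cylindrical process, `ℱ_t = σ(L s g : g ∈ G, s ∈ [0, t])`.
As `L s g` is an equivalence class, the σ-algebra is generated by all the random variables that
represent it. -/
def naturalFiltration {G Ω : Type*} {mΩ : MeasurableSpace Ω} [NormedAddCommGroup G]
    [InnerProductSpace ℝ G] {P : Measure Ω} (L : ℝ≥0 → G →ₗ[ℝ] (Ω →ₘ[P] ℝ)) :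
    Filtration ℝ≥0 mΩ where
  seq t := ⨆ (s : ℝ≥0) (_ : s ≤ t) (g : G) (f : Ω → ℝ) (_ : Measurable f)
    (_ : f =ᵐ[P] (L s g : Ω → ℝ)), MeasurableSpace.comap f inferInstance
  mono' _ _ h := iSup_mono fun _ => iSup_mono' fun hs => ⟨hs.trans h, le_rfl⟩
  le' _ := iSup_le fun _ => iSup_le fun _ => iSup_le fun _ => iSup_le fun _ =>
    iSup_le fun hf => iSup_le fun _ => hf.comap_le

/-- The copy `L̃` of `L` on the product space `Ω × Ω`: `(L̃ t g) (ω, ω') = (L t g) ω'`. -/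
noncomputable def productCopy {P : Measure Ω} [IsProbabilityMeasure P]
    (L : ℝ≥0 → G →ₗ[ℝ] (Ω →ₘ[P] ℝ)) : ℝ≥0 → G →ₗ[ℝ] (Ω × Ω →ₘ[P.prod P] ℝ) := fun t =>
  { toFun := fun g => (L t g).compMeasurePreserving Prod.snd measurePreserving_snd
    map_add' := fun g₁ g₂ => by
      rw [map_add]
      induction L t g₁ using AEEqFun.induction_on with | _ f₁ hf₁ =>
      induction L t g₂ using AEEqFun.induction_on with | _ f₂ hf₂ =>
      rfl
    map_smul' := fun c g => by
      rw [map_smul]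
      induction L t g using AEEqFun.induction_on with | _ f hf =>
      rfl }

/-- `L̃` is given by the announced formula, for any choice of representatives. -/
lemma productCopy_ae_eq {P : Measure Ω} [IsProbabilityMeasure P]
    (L : ℝ≥0 → G →ₗ[ℝ] (Ω →ₘ[P] ℝ)) (t : ℝ≥0) (g : G) :
    (productCopy L t g : Ω × Ω → ℝ) =ᵐ[P.prod P] fun p => (L t g : Ω → ℝ) p.2 :=
  AEEqFun.coeFn_compMeasurePreserving _ measurePreserving_snd

/-- Hilbert–Schmidt operators: `∑ ‖Φ aᵢ‖² < ∞` for an orthonormal basis `(aᵢ)` of `G` (the sum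
does not depend on the basis). -/
def IsHilbertSchmidt (Φ : G →L[ℝ] H) : Prop :=
  ∃ (s : Set G) (b : HilbertBasis s ℝ G), Summable fun i => ‖Φ (b i)‖ ^ 2

/-- The random variable `R : Ω → H` induces the cylindrical random variable `Φ X` in `H`, that is,
`X (Φ* h) = ⟨R, h⟩` almost surely for every `h ∈ H`. If `X` is the increment of a cylindrical
Lévy process, `R` is (a version of) the Radonified increment `Φ X`. -/
structure IsRadonification [CompleteSpace G] [CompleteSpace H] [MeasurableSpace H]
    (P : Measure Ω) (X : G →ₗ[ℝ] (Ω →ₘ[P] ℝ)) (Φ : G →L[ℝ] H) (R : Ω → H) : Prop where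
  measurable : Measurable R
  ae_eq : ∀ h : H,
    (X (ContinuousLinearMap.adjoint Φ h) : Ω → ℝ) =ᵐ[P] fun ω => inner ℝ (R ω) h

end Cylindrical

section Tangent

/-- The regular conditional distribution `ℒ(Y | m)` of an `H`-valued random variable `Y` given a
σ-algebra `m`, as a kernel from `(Ω, m)` to `H`. -/
noncomputable def condLaw {Ω H : Type*} [mΩ : MeasurableSpace Ω] [MeasurableSpace H]
    [StandardBorelSpace H] [Nonempty H] (μ : Measure Ω) [IsFiniteMeasure μ]
    (m : MeasurableSpace Ω) (Y : Ω → H) : @Kernel Ω H m _ :=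
  @condDistrib Ω Ω H _ _ _ mΩ m Y id μ _

/-- `Y₁, …, Y_N` is a decoupled tangent sequence to the `(ℱ_n)`-adapted sequence `X₁, …, X_N`;
the filtrations are indexed by `0, …, N`, and `X n`, `Y n` for `n : Fin N` stand for
`X_{n+1}`, `Y_{n+1}` in the indexing from `1` to `N`. The `Y_n` live on the product space with the
product filtration; the `X_n` are regarded as random variables on the product space through
`X (ω, ω') = X ω`. -/
structure IsDecoupledTangent {Ω Ω' H : Type*} {mΩ : MeasurableSpace Ω} {mΩ' : MeasurableSpace Ω'}
    [MeasurableSpace H] [StandardBorelSpace H] [Nonempty H]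
    (P : Measure Ω) [IsProbabilityMeasure P] (P' : Measure Ω') [IsProbabilityMeasure P'] {N : ℕ}
    (ℱ : Filtration (Fin (N + 1)) mΩ) (ℱ' : Filtration (Fin (N + 1)) mΩ')
    (X : Fin N → Ω → H) (Y : Fin N → Ω × Ω' → H) : Prop where
  adapted_left : ∀ n, Measurable[ℱ n.succ] (X n)
  adapted_right : ∀ n, Measurable[(ℱ n.succ).prod (ℱ' n.succ)] (Y n)
  indep : ∀ ω, iIndepFun (fun n ω' => Y n (ω, ω')) P'
  condLaw_eq : ∀ n, ∀ᵐ p ∂(P.prod P'),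
    condLaw (P.prod P') ((ℱ n.castSucc).prod (ℱ' n.castSucc)) (fun q => X n q.1) p =
      condLaw (P.prod P') ((ℱ n.castSucc).prod (ℱ' n.castSucc)) (Y n) p

/-- The filtration `(ℱ_{t_n})_{n = 0, …, N}` obtained by sampling at times `t₀ ≤ … ≤ t_N`. -/
def sampled {Ω : Type*} {mΩ : MeasurableSpace Ω} (ℱ : Filtration ℝ≥0 mΩ) {N : ℕ}
    (t : Fin (N + 1) → ℝ≥0) (ht : Monotone t) : Filtration (Fin (N + 1)) mΩ where
  seq n := ℱ (t n)
  mono' _ _ h := ℱ.mono (ht h)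
  le' n := ℱ.le (t n)

/-- For `Θ = ∑ₖ Φₖ 1_{Aₖ}` and versions `R k` of the Radonified increments `Φₖ (L t - L s)`, this is
`∑ₖ 1_{Aₖ}(ω) R k ω'`: the operator `Θ(ω)` applied to the increment at `ω'`. -/
noncomputable def simpleIncrement {Ω H : Type*} [AddCommMonoid H] {M : ℕ}
    (A : Fin M → Set Ω) (R : Fin M → Ω → H) (ω ω' : Ω) : H :=
  ∑ k, (A k).indicator (fun _ => R k ω') ω

end Tangent

end CylLevy

/-! Existence of Radonified increments is a Sazonov-type argument. For an orthonormal basis `e` of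
`H`, the candidate is `R = ∑ X(Φ* eᵢ) eᵢ`, so the coordinates must be almost surely square summable.
Continuity in probability gives `E(1 - cos X g) ≤ ε + C‖g‖²`. Averaging over `g = s ∑ γᵢ vᵢ` with
independent standard Gaussians `γᵢ` yields `E(1 - exp(-s² ∑ X(vᵢ)²/2)) ≤ ε + C s² ∑ ‖vᵢ‖²`. With `vᵢ
= Φ* eᵢ` the right side is controlled by the Hilbert–Schmidt norm, uniformly over finite sums
(`IsCylindricalRV.ae_summable_sq`).

Tangency rests on one fact: the increments `R_{n,k}` are jointly independent of `ℱ_{t_{n-1}}`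
(`indep_naturalFiltration`). Both `X_n` and `Y_n` have the form `S(ω, V)`, where `S` is measurable
for `ℱ_{t_{n-1}}` times Borel and `V` is the vector of increments at `ω` or at `ω'`. Under `P ⊗ P`
either version of `V` is independent of `ℱ_{t_{n-1}} ⊗ ℱ_{t_{n-1}}` and has the same law, so the
conditional laws coincide (`condLaw_eq_of_indep`).

For frozen `ω`, `Y_n(ω, ·)` is a fixed linear combination of Radonified increments. Its scalar
projections are increments of `L` at deterministic vectors, and characteristic functions lift their
independence to `H`. The assertions on the copy follow because the second projection preserves
measure. -/

namespace CylLevy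

/-! ### Hilbert–Schmidt operators Radonify cylindrical random variables. -/

section Radonification

/-- An orthonormal family in a separable space is countable. -/
lemma countable_of_orthonormal {ι E : Type*} [NormedAddCommGroup E] [InnerProductSpace ℝ E]
    [SecondCountableTopology E] {v : ι → E} (hv : Orthonormal ℝ v) : Countable ι := by
  classical
  -- The distance is in fact `√2`; the bound `1` already makes the balls of radius `1/2` disjoint.
  have hd : ∀ i j, i ≠ j → 1 ≤ dist (v i) (v j) := by
    intro i j hij
    have h := norm_sub_sq_real (v i) (v j)
    rw [hv.1 i, hv.1 j, hv.2 hij] at h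
    rw [dist_eq_norm]
    nlinarith [norm_nonneg (v i - v j)]
  let s : ι → Set E := fun i => Metric.ball (v i) (1 / 2)
  have hs : Pairwise (Function.onFun Disjoint s) := fun i j hij =>
    Metric.ball_disjoint_ball (by linarith [hd i j hij])
  exact hs.countable_of_isOpen_disjoint (fun i => Metric.isOpen_ball)
    (fun i => ⟨v i, Metric.mem_ball_self (by norm_num)⟩)

lemma one_sub_cos_le_abs (x : ℝ) : 1 - Real.cos x ≤ |x| := by
  have h := Real.one_sub_sq_div_two_le_cos (x := x)
  have h2 := Real.neg_one_le_cos x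
  rcases le_total |x| 2 with hx | hx
  · nlinarith [sq_abs x, abs_nonneg x]
  · linarith

lemma coeFn_map_sum_smul {ι G Ω : Type*} [MeasurableSpace Ω] [NormedAddCommGroup G]
    [InnerProductSpace ℝ G] {P : Measure Ω} (X : G →ₗ[ℝ] (Ω →ₘ[P] ℝ)) (c : ι → ℝ) (v : ι → G)
    (F : Finset ι) :
    (X (∑ i ∈ F, c i • v i) : Ω → ℝ) =ᵐ[P] fun ω => ∑ i ∈ F, c i * (X (v i) : Ω → ℝ) ω := by
  classical
  induction F using Finset.induction_on with
  | empty =>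
    rw [Finset.sum_empty, map_zero]
    filter_upwards [AEEqFun.coeFn_zero (α := Ω) (μ := P) (β := ℝ)] with ω hω
    simp [hω]
  | insert i F hi ih =>
    rw [Finset.sum_insert hi, map_add, map_smul]
    filter_upwards [AEEqFun.coeFn_add (c i • X (v i)) (X (∑ i ∈ F, c i • v i)), ih,
      AEEqFun.coeFn_smul (c i) (X (v i))] with ω h1 h2 h3
    rw [h1, Pi.add_apply, h2, h3, Finset.sum_insert hi]; simp

/-- The function `g ↦ E cos (X g)` of a cylindrical random variable is close to `1` up to a
quadratic error. -/
lemma IsCylindricalRV.integral_one_sub_cos_le {G Ω : Type*} [MeasurableSpace Ω]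
    [NormedAddCommGroup G] [InnerProductSpace ℝ G] {P : Measure Ω} [IsProbabilityMeasure P]
    {X : G →ₗ[ℝ] (Ω →ₘ[P] ℝ)} (hX : IsCylindricalRV P X) {ε : ℝ} (hε : 0 < ε) :
    ∃ C : ℝ, 0 ≤ C ∧ ∀ g : G, ∫ ω, (1 - Real.cos ((X g : Ω → ℝ) ω)) ∂P ≤ ε + C * ‖g‖ ^ 2 := by
  -- Budget for small `g`: `ε/3` where `|X g| < ε/3`, and at most `2 · ε/3` from the exceptional
  -- event, as `1 - cos ≤ 2`.
  have hη : 0 < ε / 3 := by positivity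
  have h0 := (tendstoInMeasure_iff_dist.1 (hX 0)) (ε / 3) hη
  have hev : ∀ᶠ g in 𝓝 (0 : G),
      P {ω | ε / 3 ≤ dist ((X g : Ω → ℝ) ω) ((X 0 : Ω → ℝ) ω)} < ENNReal.ofReal (ε / 3) :=
    h0.eventually_lt_const (by simpa using hη)
  obtain ⟨δ, hδ, hball⟩ := Metric.eventually_nhds_iff.1 hev
  have hX0 : (X 0 : Ω → ℝ) =ᵐ[P] 0 := by
    rw [map_zero]; exact AEEqFun.coeFn_zero
  have hmeas : ∀ g, Measurable (X g : Ω → ℝ) := fun g => (X g).measurable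
  -- With this constant the quadratic term dominates the trivial bound `2` once `‖g‖ ≥ δ`.
  refine ⟨2 / δ ^ 2, by positivity, fun g => ?_⟩
  by_cases hg : ‖g‖ < δ
  · have hlt := hball (y := g) (by simpa using hg)
    set S : Set Ω := {ω | ε / 3 ≤ |(X g : Ω → ℝ) ω|} with hS
    have hSm : MeasurableSet S := measurableSet_le measurable_const (hmeas g).abs
    have hPS : P.real S ≤ ε / 3 := by
      have : P S = P {ω | ε / 3 ≤ dist ((X g : Ω → ℝ) ω) ((X 0 : Ω → ℝ) ω)} := by
        apply measure_congr
        filter_upwards [hX0] with ω hω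
        change (ε / 3 ≤ |(X g : Ω → ℝ) ω|) = (ε / 3 ≤ dist ((X g : Ω → ℝ) ω) ((X 0 : Ω → ℝ) ω))
        rw [hω]; simp
      rw [Measure.real, this]
      exact ENNReal.toReal_le_of_le_ofReal hη.le hlt.le
    have hle : ∀ ω, 1 - Real.cos ((X g : Ω → ℝ) ω) ≤ ε / 3 + S.indicator (fun _ => (2 : ℝ)) ω := by
      intro ω
      by_cases hω : ω ∈ S
      · rw [Set.indicator_of_mem hω]
        linarith [Real.neg_one_le_cos ((X g : Ω → ℝ) ω)]
      · rw [Set.indicator_of_notMem hω]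
        have : |(X g : Ω → ℝ) ω| < ε / 3 := not_le.1 hω
        linarith [one_sub_cos_le_abs ((X g : Ω → ℝ) ω)]
    have hint : Integrable (S.indicator (fun _ => (2 : ℝ))) P :=
      (integrable_const _).indicator hSm
    calc ∫ ω, (1 - Real.cos ((X g : Ω → ℝ) ω)) ∂P
        ≤ ∫ ω, (ε / 3 + S.indicator (fun _ => (2 : ℝ)) ω) ∂P :=
          integral_mono_of_nonneg (.of_forall fun ω => by simp [Real.cos_le_one])
            ((integrable_const _).add hint) (.of_forall hle)
      _ = ε / 3 + P.real S * 2 := by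
          rw [integral_add (integrable_const _) hint, integral_indicator_const _ hSm]; simp
      _ ≤ ε + 2 / δ ^ 2 * ‖g‖ ^ 2 := by
          have : 0 ≤ 2 / δ ^ 2 * ‖g‖ ^ 2 := by positivity
          linarith
  · have hg' : δ ≤ ‖g‖ := not_lt.1 hg
    calc ∫ ω, (1 - Real.cos ((X g : Ω → ℝ) ω)) ∂P
        ≤ ∫ _, (2 : ℝ) ∂P :=
          integral_mono_of_nonneg (.of_forall fun ω => by simp [Real.cos_le_one])
            (integrable_const _)
            (.of_forall fun ω => by simp only; linarith [Real.neg_one_le_cos ((X g : Ω → ℝ) ω)])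
      _ = 2 := by simp
      _ ≤ 2 / δ ^ 2 * ‖g‖ ^ 2 := by
          rw [div_mul_eq_mul_div, le_div_iff₀ (by positivity)]
          have := pow_le_pow_left₀ hδ.le hg' 2
          linarith
      _ ≤ _ := by linarith

/-- The Gaussian integral representation `E cos ⟨a, γ⟩ = exp (-|a|² / 2)`. -/
lemma integral_cos_inner_stdGaussian {ι : Type*} [Fintype ι] (a : EuclideanSpace ℝ ι) :
    ∫ x, Real.cos (inner ℝ x a) ∂(stdGaussian (EuclideanSpace ℝ ι)) = Real.exp (-‖a‖ ^ 2 / 2) := by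
  have h := congrArg Complex.re (charFun_stdGaussian a)
  rw [charFun_apply] at h
  have hint : Integrable (fun x : EuclideanSpace ℝ ι => Complex.exp (inner ℝ x a * Complex.I))
      (stdGaussian (EuclideanSpace ℝ ι)) := by
    refine Integrable.of_bound (C := 1) (by fun_prop) (.of_forall fun x => ?_)
    rw [Complex.norm_exp_ofReal_mul_I]
  rw [← RCLike.re_eq_complex_re, ← integral_re hint] at h
  simp only [RCLike.re_eq_complex_re, Complex.exp_ofReal_mul_I_re] at h
  rw [h]
  have : (-(‖a‖ : ℂ) ^ 2 / 2) = ((-‖a‖ ^ 2 / 2 : ℝ) : ℂ) := by push_cast; ring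
  rw [this, ← Complex.ofReal_exp, Complex.ofReal_re]

lemma memLp_eval_stdGaussian {ι : Type*} [Fintype ι] (i : ι) :
    MemLp (fun x : EuclideanSpace ℝ ι => x i) 2 (stdGaussian (EuclideanSpace ℝ ι)) :=
  IsGaussian.memLp_dual _ (EuclideanSpace.proj i : EuclideanSpace ℝ ι →L[ℝ] ℝ) 2 (by simp)

lemma integral_mul_stdGaussian {ι : Type*} [Fintype ι] [DecidableEq ι] (i j : ι) :
    ∫ x : EuclideanSpace ℝ ι, x i * x j ∂(stdGaussian (EuclideanSpace ℝ ι)) =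
      if i = j then 1 else 0 := by
  have h := covariance_eval_multivariateGaussian (μ := (0 : EuclideanSpace ℝ ι))
    (S := (1 : Matrix ι ι ℝ)) Matrix.PosSemidef.one i j
  rw [multivariateGaussian_zero_one, covariance_eq_sub] at h
  · have hz : ∀ k, ∫ x : EuclideanSpace ℝ ι, x k ∂(stdGaussian (EuclideanSpace ℝ ι)) = 0 :=
      fun k => integral_strongDual_stdGaussian (EuclideanSpace.proj k : EuclideanSpace ℝ ι →L[ℝ] ℝ)
    rw [hz i, hz j] at h
    simpa [Matrix.one_apply] using h
  all_goals
    exact memLp_eval_stdGaussian _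

lemma integral_norm_sum_smul_sq_stdGaussian {ι G : Type*} [Fintype ι] [NormedAddCommGroup G]
    [InnerProductSpace ℝ G] (v : ι → G) :
    Integrable (fun x : EuclideanSpace ℝ ι => ‖∑ i, x i • v i‖ ^ 2)
        (stdGaussian (EuclideanSpace ℝ ι)) ∧
      ∫ x : EuclideanSpace ℝ ι, ‖∑ i, x i • v i‖ ^ 2 ∂(stdGaussian (EuclideanSpace ℝ ι)) =
        ∑ i, ‖v i‖ ^ 2 := by
  classical
  have hL : ∀ i, MemLp (fun x : EuclideanSpace ℝ ι => x i) 2 (stdGaussian (EuclideanSpace ℝ ι)) :=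
    memLp_eval_stdGaussian
  have hexp : ∀ x : EuclideanSpace ℝ ι,
      ‖∑ i, x i • v i‖ ^ 2 = ∑ i, ∑ j, x i * x j * inner ℝ (v i) (v j) := by
    intro x
    rw [← real_inner_self_eq_norm_sq, sum_inner]
    refine Finset.sum_congr rfl fun i _ => ?_
    rw [inner_sum]
    refine Finset.sum_congr rfl fun j _ => ?_
    rw [real_inner_smul_left, real_inner_smul_right]; ring
  have hij : ∀ i j, Integrable (fun x : EuclideanSpace ℝ ι => x i * x j * inner ℝ (v i) (v j))
      (stdGaussian (EuclideanSpace ℝ ι)) := fun i j => ((hL i).integrable_mul (hL j)).mul_const _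
  simp_rw [hexp]
  refine ⟨integrable_finsetSum _ fun i _ => integrable_finsetSum _ fun j _ => hij i j, ?_⟩
  rw [integral_finsetSum _ fun i _ => integrable_finsetSum _ fun j _ => hij i j]
  refine Finset.sum_congr rfl fun i _ => ?_
  rw [integral_finsetSum _ fun j _ => hij i j]
  simp_rw [integral_mul_const, integral_mul_stdGaussian]
  simp

/-- Coordinates of a cylindrical random variable along a finite family have a Gaussian-averaged
tail estimate. -/
lemma integral_one_sub_exp_le {ι G Ω : Type*} [Fintype ι] [MeasurableSpace Ω]
    [NormedAddCommGroup G] [InnerProductSpace ℝ G] {P : Measure Ω} [IsProbabilityMeasure P]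
    (X : G →ₗ[ℝ] (Ω →ₘ[P] ℝ)) {ε C : ℝ}
    (hX : ∀ g : G, ∫ ω, (1 - Real.cos ((X g : Ω → ℝ) ω)) ∂P ≤ ε + C * ‖g‖ ^ 2)
    (v : ι → G) (s : ℝ) :
    ∫ ω, (1 - Real.exp (-(s ^ 2 * ∑ i, (X (v i) : Ω → ℝ) ω ^ 2) / 2)) ∂P ≤
      ε + C * (s ^ 2 * ∑ i, ‖v i‖ ^ 2) := by
  set γ := stdGaussian (EuclideanSpace ℝ ι) with hγ
  have hmeas : ∀ g, Measurable (X g : Ω → ℝ) := fun g => (X g).measurable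
  let a : Ω → EuclideanSpace ℝ ι := fun ω => s • WithLp.toLp 2 fun i => (X (v i) : Ω → ℝ) ω
  have ha : Measurable a := by
    refine Measurable.const_smul ?_ s
    exact (PiLp.continuous_toLp 2 _).measurable.comp (measurable_pi_lambda _ fun i => hmeas _)
  have hina : Measurable fun p : Ω × EuclideanSpace ℝ ι => inner ℝ p.2 (a p.1) :=
    measurable_snd.inner (ha.comp measurable_fst)
  have hint : Integrable (Function.uncurry fun (ω : Ω) (x : EuclideanSpace ℝ ι) =>
      1 - Real.cos (inner ℝ x (a ω))) (P.prod γ) := by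
    refine Integrable.of_bound (C := 2) ?_ (.of_forall fun p => ?_)
    · exact (measurable_const.sub (Real.measurable_cos.comp hina)).aestronglyMeasurable
    · rw [Real.norm_eq_abs, abs_le]
      constructor <;> simp only [Function.uncurry] <;>
        linarith [Real.neg_one_le_cos (inner ℝ p.2 (a p.1)), Real.cos_le_one (inner ℝ p.2 (a p.1))]
  have hcosint : ∀ ω, Integrable (fun x : EuclideanSpace ℝ ι => Real.cos (inner ℝ x (a ω))) γ := by
    intro ω
    refine Integrable.of_bound (C := 1) ?_ (.of_forall fun p => ?_)
    · exact (Real.continuous_cos.comp (by fun_prop)).aestronglyMeasurable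
    · simpa using Real.abs_cos_le_one _
  -- The exponential becomes a Gaussian average of cosines. After Fubini, linearity makes the inner
  -- integral the hypothesis at the vector `s ∑ xᵢ vᵢ`.
  have h1 : ∀ ω, 1 - Real.exp (-(s ^ 2 * ∑ i, (X (v i) : Ω → ℝ) ω ^ 2) / 2) =
      ∫ x, (1 - Real.cos (inner ℝ x (a ω))) ∂γ := by
    intro ω
    rw [integral_sub (integrable_const _) (hcosint ω), integral_cos_inner_stdGaussian]
    simp [a, norm_smul, mul_pow, EuclideanSpace.norm_sq_eq]
  simp_rw [h1]
  rw [integral_integral_swap hint]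
  have h2 : ∀ x : EuclideanSpace ℝ ι,
      ∫ ω, (1 - Real.cos (inner ℝ x (a ω))) ∂P ≤ ε + C * (s ^ 2 * ‖∑ i, x i • v i‖ ^ 2) := by
    intro x
    have h := hX (s • ∑ i, x i • v i)
    rw [norm_smul, mul_pow, Real.norm_eq_abs, sq_abs] at h
    refine le_of_eq_of_le (integral_congr_ae ?_) h
    have hsum : (X (s • ∑ i, x i • v i) : Ω → ℝ) =ᵐ[P]
        fun ω => s * ∑ i, x i * (X (v i) : Ω → ℝ) ω := by
      rw [map_smul]
      refine (AEEqFun.coeFn_smul _ _).trans ?_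
      filter_upwards [coeFn_map_sum_smul X (fun i => x i) v Finset.univ] with ω hω
      rw [Pi.smul_apply, hω, smul_eq_mul]
    filter_upwards [hsum] with ω hω
    rw [hω]
    simp only [a, real_inner_smul_right]
    simp [PiLp.inner_apply, mul_comm]
  obtain ⟨hi, he⟩ := integral_norm_sum_smul_sq_stdGaussian v
  calc ∫ x, ∫ ω, (1 - Real.cos (inner ℝ x (a ω))) ∂P ∂γ
      ≤ ∫ x : EuclideanSpace ℝ ι, (ε + C * (s ^ 2 * ‖∑ i, x i • v i‖ ^ 2)) ∂γ :=
        integral_mono_of_nonneg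
          (.of_forall fun x => integral_nonneg fun ω => by simp [Real.cos_le_one])
          ((integrable_const _).add ((hi.const_mul _).const_mul _)) (.of_forall h2)
    _ = _ := by
        rw [integral_add (integrable_const _) ((hi.const_mul _).const_mul _), integral_const_mul,
          integral_const_mul, he]
        simp

/-- The squared Hilbert–Schmidt norm of the adjoint, along finite orthonormal families. -/
lemma IsHilbertSchmidt.exists_sum_adjoint_le {G H : Type*}
    [NormedAddCommGroup G] [InnerProductSpace ℝ G] [CompleteSpace G]
    [NormedAddCommGroup H] [InnerProductSpace ℝ H] [CompleteSpace H]
    {Φ : G →L[ℝ] H} (hΦ : IsHilbertSchmidt Φ) :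
    ∃ K : ℝ, ∀ {ι : Type _} (e : ι → H), Orthonormal ℝ e → ∀ F : Finset ι,
      ∑ j ∈ F, ‖ContinuousLinearMap.adjoint Φ (e j)‖ ^ 2 ≤ K := by
  obtain ⟨s, b, hb⟩ := hΦ
  refine ⟨∑' i, ‖Φ (b i)‖ ^ 2, fun {ι} e he F => ?_⟩
  -- Parseval in `G` for each `j`; after exchanging the sums, Bessel's inequality in `H` bounds the
  -- term of each `i`.
  have h1 : ∀ j, HasSum (fun i => (inner ℝ (e j) (Φ (b i)) : ℝ) ^ 2)
      (‖ContinuousLinearMap.adjoint Φ (e j)‖ ^ 2) := by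
    intro j
    have h := b.hasSum_inner_mul_inner (ContinuousLinearMap.adjoint Φ (e j))
      (ContinuousLinearMap.adjoint Φ (e j))
    rw [real_inner_self_eq_norm_sq] at h
    refine Eq.subst (motive := fun f => HasSum f _) (funext fun i => ?_) h
    rw [ContinuousLinearMap.adjoint_inner_left, ContinuousLinearMap.adjoint_inner_right,
      real_inner_comm (e j), sq]
  have h2 := hasSum_sum (s := F) fun j _ => h1 j
  refine hasSum_le (fun i => ?_) h2 hb.hasSum
  simpa using he.sum_inner_products_le (Φ (b i)) (s := F)

variable {G H Ω : Type*} [MeasurableSpace Ω]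
  [NormedAddCommGroup G] [InnerProductSpace ℝ G]
  [NormedAddCommGroup H] [InnerProductSpace ℝ H] {P : Measure Ω} [IsProbabilityMeasure P]

/-- Markov's inequality for `1 - exp(-s² ∑ X(vᵢ)²/2)` with `s² = 2/l`: on the event the exponent is
at most `-1`, and `1 - e⁻¹ > 1/2`, whence the factor `2`. -/
lemma measure_sum_sq_gt_le {ι : Type*} (X : G →ₗ[ℝ] (Ω →ₘ[P] ℝ)) {ε C : ℝ}
    (hX : ∀ g : G, ∫ ω, (1 - Real.cos ((X g : Ω → ℝ) ω)) ∂P ≤ ε + C * ‖g‖ ^ 2)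
    (v : ι → G) (F : Finset ι) {l : ℝ} (hl : 0 < l) :
    P.real {ω | l < ∑ i ∈ F, (X (v i) : Ω → ℝ) ω ^ 2} ≤
      2 * (ε + C * (2 / l * ∑ i ∈ F, ‖v i‖ ^ 2)) := by
  have h := integral_one_sub_exp_le X hX (fun i : F => v i) (√(2 / l))
  rw [Real.sq_sqrt (by positivity), Finset.sum_coe_sort F fun i => ‖v i‖ ^ 2] at h
  have hF : ∀ ω, ∑ i : F, (X (v i) : Ω → ℝ) ω ^ 2 = ∑ i ∈ F, (X (v i) : Ω → ℝ) ω ^ 2 :=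
    fun ω => Finset.sum_coe_sort F fun i => (X (v i) : Ω → ℝ) ω ^ 2
  simp_rw [hF] at h
  set S : Set Ω := {ω | l < ∑ i ∈ F, (X (v i) : Ω → ℝ) ω ^ 2}
  have hmeas : Measurable fun ω => ∑ i ∈ F, (X (v i) : Ω → ℝ) ω ^ 2 :=
    Finset.measurable_sum _ fun i _ => (X (v i)).measurable.pow_const 2
  have hS : MeasurableSet S := measurableSet_lt measurable_const hmeas
  have hbd : ∀ ω, 0 ≤ 1 - Real.exp (-(2 / l * ∑ i ∈ F, (X (v i) : Ω → ℝ) ω ^ 2) / 2) := by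
    intro ω
    have : 0 ≤ 2 / l * ∑ i ∈ F, (X (v i) : Ω → ℝ) ω ^ 2 := by positivity
    have := Real.exp_le_one_iff.2
      (show -(2 / l * ∑ i ∈ F, (X (v i) : Ω → ℝ) ω ^ 2) / 2 ≤ 0 by linarith)
    linarith
  have hint : Integrable
      (fun ω => 1 - Real.exp (-(2 / l * ∑ i ∈ F, (X (v i) : Ω → ℝ) ω ^ 2) / 2)) P := by
    refine Integrable.of_bound (C := 1) ?_ (.of_forall fun ω => ?_)
    · exact (measurable_const.sub (Real.measurable_exp.comp
        (((hmeas.const_mul _).neg).div_const _))).aestronglyMeasurable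
    · rw [Real.norm_of_nonneg (hbd ω)]
      linarith [Real.exp_pos (-(2 / l * ∑ i ∈ F, (X (v i) : Ω → ℝ) ω ^ 2) / 2)]
  have hle : ∫ ω, S.indicator (fun _ => (1 / 2 : ℝ)) ω ∂P ≤
      ∫ ω, (1 - Real.exp (-(2 / l * ∑ i ∈ F, (X (v i) : Ω → ℝ) ω ^ 2) / 2)) ∂P := by
    refine integral_mono ((integrable_const _).indicator hS) hint fun ω => ?_
    by_cases hω : ω ∈ S
    · rw [Set.indicator_of_mem hω]
      have hω' : l < ∑ i ∈ F, (X (v i) : Ω → ℝ) ω ^ 2 := hω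
      have h1 : -(2 / l * ∑ i ∈ F, (X (v i) : Ω → ℝ) ω ^ 2) / 2 ≤ -1 := by
        have : 1 ≤ (∑ i ∈ F, (X (v i) : Ω → ℝ) ω ^ 2) / l := (one_le_div hl).2 hω'.le
        have e : 2 / l * ∑ i ∈ F, (X (v i) : Ω → ℝ) ω ^ 2 =
          2 * ((∑ i ∈ F, (X (v i) : Ω → ℝ) ω ^ 2) / l) := by ring
        rw [e]; linarith
      have h2 := Real.exp_le_exp.2 h1
      have h3 := Real.exp_neg_one_lt_half
      simp only; linarith
    · rw [Set.indicator_of_notMem hω]; exact hbd ω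
  rw [integral_indicator_const _ hS, smul_eq_mul] at hle
  linarith

/-- The coordinates of a cylindrical random variable along a square summable family are
almost surely square summable. -/
lemma IsCylindricalRV.ae_summable_sq {ι : Type*} [Countable ι] {X : G →ₗ[ℝ] (Ω →ₘ[P] ℝ)}
    (hX : IsCylindricalRV P X) {v : ι → G} {K : ℝ} (hv : ∀ F : Finset ι, ∑ i ∈ F, ‖v i‖ ^ 2 ≤ K) :
    ∀ᵐ ω ∂P, Summable fun i => (X (v i) : Ω → ℝ) ω ^ 2 := by
  have hK : 0 ≤ K := by simpa using hv ∅
  have key : ∀ ε : ℝ, 0 < ε →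
      P {ω | ¬ Summable fun i => (X (v i) : Ω → ℝ) ω ^ 2} ≤ ENNReal.ofReal ε := by
    intro ε hε
    obtain ⟨C, hC, hcos⟩ := hX.integral_one_sub_cos_le (ε := ε / 4) (by positivity)
    -- Chosen so that `C · (2/l) · K ≤ ε/4`, giving the total `2(ε/4 + ε/4) = ε`; the `+ 1` keeps
    -- `l` positive when `C * K = 0`.
    set l : ℝ := 8 * (C * K + 1) / ε
    have hl : 0 < l := by positivity
    let S : Finset ι → Set Ω := fun F => {ω | l < ∑ i ∈ F, (X (v i) : Ω → ℝ) ω ^ 2}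
    have hmono : Monotone S := fun F F' hF ω (hω : l < _) => lt_of_lt_of_le hω
      (Finset.sum_le_sum_of_subset_of_nonneg hF fun _ _ _ => sq_nonneg _)
    have hsub : {ω | ¬ Summable fun i => (X (v i) : Ω → ℝ) ω ^ 2} ⊆ ⋃ F, S F := by
      intro ω hω
      by_contra hcon
      refine hω (summable_of_sum_le (c := l) (fun i => sq_nonneg _) fun F => ?_)
      by_contra hF
      exact hcon (Set.mem_iUnion.2 ⟨F, not_le.1 hF⟩)
    refine (measure_mono hsub).trans ?_
    -- Continuity from below along the directed family of finite sets; the bound is uniform in `F`.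
    rw [hmono.directed_le.measure_iUnion]
    refine iSup_le fun F => ?_
    rw [← ofReal_measureReal]
    refine ENNReal.ofReal_le_ofReal ((measure_sum_sq_gt_le X hcos v F hl).trans ?_)
    have h1 : C * (2 / l * ∑ i ∈ F, ‖v i‖ ^ 2) ≤ C * (2 / l * K) := by gcongr; exact hv F
    have h2 : C * (2 / l * K) ≤ ε / 4 := by
      have e : C * (2 / l * K) = (C * K) / (C * K + 1) * (ε / 4) := by
        simp only [l]; field_simp; ring
      rw [e]
      have : C * K / (C * K + 1) ≤ 1 := (div_le_one (by positivity)).2 (by linarith)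
      nlinarith
    linarith
  rw [ae_iff]
  refine le_antisymm (ENNReal.le_of_forall_pos_le_add fun ε hε _ => ?_) zero_le
  simpa using key ε hε

/-- Hilbert–Schmidt operators map cylindrical random variables to genuine ones. -/
theorem IsCylindricalRV.exists_isRadonification [CompleteSpace G] [CompleteSpace H]
    [SecondCountableTopology H] [MeasurableSpace H] [BorelSpace H] {X : G →ₗ[ℝ] (Ω →ₘ[P] ℝ)}
    (hX : IsCylindricalRV P X) {Φ : G →L[ℝ] H} (hΦ : IsHilbertSchmidt Φ) :
    ∃ R : Ω → H, IsRadonification P X Φ R := by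
  obtain ⟨w, e, -⟩ := exists_hilbertBasis ℝ H
  have : Countable w := countable_of_orthonormal e.orthonormal
  set T := ContinuousLinearMap.adjoint Φ
  obtain ⟨K, hK⟩ := hΦ.exists_sum_adjoint_le
  let f : Finset w → Ω → H := fun F ω => ∑ i ∈ F, (X (T (e i)) : Ω → ℝ) ω • e i
  have hf : ∀ F, Measurable (f F) := fun F =>
    Finset.measurable_sum _ fun i _ => (X (T (e i))).measurable.smul_const _
  have hlim : ∀ᵐ ω ∂P, ∃ l, Tendsto (fun F => f F ω) atTop (𝓝 l) := by
    filter_upwards [hX.ae_summable_sq (hK e e.orthonormal)] with ω hω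
    have hmem : Memℓp (fun i => (X (T (e i)) : Ω → ℝ) ω) 2 := by
      refine memℓp_gen ?_
      simpa using hω
    exact ⟨_, e.hasSum_repr_symm ⟨_, hmem⟩⟩
  obtain ⟨R, hR, hRlim⟩ :=
    measurable_limit_of_tendsto_metrizable_ae (fun F => (hf F).aemeasurable) hlim
  refine ⟨R, hR, fun h => ?_⟩
  -- To identify `⟨R, h⟩`, expand `h` in the basis: `X` is continuous only in probability, so its
  -- values along the partial sums are compared with `⟨R, h⟩` on an almost surely convergent
  -- subsequence.
  have hTh : Tendsto (fun F : Finset w => T (∑ i ∈ F, e.repr h i • e i)) atTop (𝓝 (T h)) :=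
    (T.continuous.tendsto h).comp (e.hasSum_repr h)
  have hmeas : TendstoInMeasure P
      (fun (F : Finset w) => (X (T (∑ i ∈ F, e.repr h i • e i)) : Ω → ℝ))
      atTop (X (T h)) := fun ε hε => (hX (T h) ε hε).comp hTh
  obtain ⟨ns, hns, hae⟩ := hmeas.exists_seq_tendsto_ae'
  have hsum : ∀ᵐ ω ∂P, ∀ F : Finset w, (X (T (∑ i ∈ F, e.repr h i • e i)) : Ω → ℝ) ω =
      ∑ i ∈ F, e.repr h i * (X (T (e i)) : Ω → ℝ) ω := by
    rw [ae_all_iff]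
    intro F
    rw [map_sum]
    simp_rw [map_smul T]
    exact coeFn_map_sum_smul X _ _ F
  filter_upwards [hae, hRlim, hsum] with ω h1 h2 h3
  refine tendsto_nhds_unique h1 ?_
  have h4 : Tendsto (fun F => inner ℝ (f F ω) h) atTop (𝓝 (inner ℝ (R ω) h)) :=
    h2.inner tendsto_const_nhds
  refine (h4.comp hns).congr fun n => ?_
  rw [h3]
  simp only [Function.comp, f, sum_inner, real_inner_smul_left, e.repr_apply_apply]
  exact Finset.sum_congr rfl fun i _ => mul_comm (_ : ℝ) _

end Radonification

/-! ### Independence through scalar projections, and independence from a finite past. -/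

section Independence

/-- Random variables in Hilbert spaces are independent if their one-dimensional projections are. -/
lemma iIndepFun_of_inner {Ω ι : Type*} [Fintype ι] [MeasurableSpace Ω] {P : Measure Ω}
    [IsProbabilityMeasure P] {H : ι → Type*} [∀ i, NormedAddCommGroup (H i)]
    [∀ i, InnerProductSpace ℝ (H i)] [∀ i, CompleteSpace (H i)]
    [∀ i, SecondCountableTopology (H i)] [∀ i, MeasurableSpace (H i)] [∀ i, BorelSpace (H i)]
    {S : ∀ i, Ω → H i} (hS : ∀ i, Measurable (S i))
    (h : ∀ a : ∀ i, H i, iIndepFun (fun i ω => (inner ℝ (S i ω) (a i) : ℝ)) P) :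
    iIndepFun S P := by
  rw [iIndepFun_iff_charFun_pi fun i => (hS i).aemeasurable]
  intro a
  have hm : ∀ i, Measurable fun ω => (inner ℝ (S i ω) (a i) : ℝ) := fun i =>
    (hS i).inner measurable_const
  -- The characteristic function of `∑ᵢ ⟨Sᵢ, aᵢ⟩` at `1` is the joint characteristic function of `S`
  -- at `a`.
  have h1 := congrFun ((h a).charFun_map_fun_sum_eq_prod fun i => (hm i).aemeasurable) 1
  rw [Finset.prod_apply] at h1
  simp only [charFun_apply] at h1 ⊢
  rw [integral_map (by fun_prop) (by fun_prop)] at h1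
  have hS' : Measurable fun ω => WithLp.toLp 2 fun i => S i ω :=
    (PiLp.continuous_toLp 2 _).measurable.comp (measurable_pi_lambda _ hS)
  rw [integral_map hS'.aemeasurable (by fun_prop)]
  simp only [PiLp.inner_apply]
  convert h1 using 1
  · simp
  · refine Finset.prod_congr rfl fun i _ => ?_
    rw [integral_map (hS i).aemeasurable (by fun_prop), integral_map (hm i).aemeasurable
      (by fun_prop)]
    simp

/-- The characteristic-function argument for a pair: the joint characteristic function at `(a, b)`
is that of `⟨S, a⟩ + ⟨T, b⟩` at `1`. -/
lemma indepFun_of_inner {Ω E F : Type*} [MeasurableSpace Ω] {P : Measure Ω}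
    [IsProbabilityMeasure P] [NormedAddCommGroup E] [InnerProductSpace ℝ E] [CompleteSpace E]
    [SecondCountableTopology E] [MeasurableSpace E] [BorelSpace E]
    [NormedAddCommGroup F] [InnerProductSpace ℝ F] [CompleteSpace F]
    [SecondCountableTopology F] [MeasurableSpace F] [BorelSpace F]
    {S : Ω → E} {T : Ω → F} (hS : Measurable S) (hT : Measurable T)
    (h : ∀ a b, IndepFun (fun ω => (inner ℝ (S ω) a : ℝ)) (fun ω => (inner ℝ (T ω) b : ℝ)) P) :
    IndepFun S T P := by
  rw [indepFun_iff_charFun_prod hS.aemeasurable hT.aemeasurable]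
  intro a
  have hm1 : Measurable fun ω => (inner ℝ (S ω) a.ofLp.1 : ℝ) := hS.inner measurable_const
  have hm2 : Measurable fun ω => (inner ℝ (T ω) a.ofLp.2 : ℝ) := hT.inner measurable_const
  have h1 := congrFun ((h a.ofLp.1 a.ofLp.2).charFun_map_fun_add_eq_mul hm1.aemeasurable
    hm2.aemeasurable) 1
  rw [Pi.mul_apply] at h1
  simp only [charFun_apply] at h1 ⊢
  rw [integral_map (by fun_prop) (by fun_prop), integral_map (by fun_prop) (by fun_prop),
    integral_map (by fun_prop) (by fun_prop)] at h1
  rw [integral_map (by fun_prop) (by fun_prop), integral_map (by fun_prop) (by fun_prop),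
    integral_map (by fun_prop) (by fun_prop)]
  simpa [WithLp.prod_inner_apply] using h1

/-- The increments after time `s` of a process with independent increments are independent of
its values at finitely many earlier times. -/
lemma HasIndepIncrements.indepFun_finite_past {Ω E κ : Type*} [MeasurableSpace Ω] {P : Measure Ω}
    [NormedAddCommGroup E] [MeasurableSpace E] [BorelSpace E] [SecondCountableTopology E]
    {X : ℝ≥0 → Ω → E} [Finite κ] (hX : HasIndepIncrements X P) (hm : ∀ t, Measurable (X t))
    (h0 : X 0 =ᵐ[P] 0) (r : κ → ℝ≥0) {s t : ℝ≥0} (hr : ∀ j, r j ≤ s) (hst : s ≤ t) :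
    IndepFun (fun ω j => X (r j) ω) (fun ω => X t ω - X s ω) P := by
  classical
  have := Fintype.ofFinite κ
  -- The grid contains `0`, so that each `X (r j)` telescopes into increments, and `s`, its maximum.
  -- Continued by the constant `t`, its increment number `S.card - 1` is exactly `X t - X s`.
  let S : Finset ℝ≥0 := insert 0 (insert s (Finset.univ.image r))
  have hSs : ∀ x ∈ S, x ≤ s := by
    intro x hx
    simp only [S, Finset.mem_insert, Finset.mem_image, Finset.mem_univ, true_and] at hx
    rcases hx with rfl | rfl | ⟨j, rfl⟩
    · exact zero_le
    · exact le_rfl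
    · exact hr j
  let o := S.orderEmbOfFin rfl
  let τ : ℕ → ℝ≥0 := fun i => if h : i < S.card then o ⟨i, h⟩ else t
  have hτ : Monotone τ := by
    intro i j hij
    simp only [τ]
    by_cases hj : j < S.card
    · rw [dif_pos hj, dif_pos (hij.trans_lt hj)]
      exact o.monotone hij
    · rw [dif_neg hj]
      split_ifs with hi
      · exact (hSs _ (S.orderEmbOfFin_mem rfl _)).trans hst
      · exact le_rfl
  have hex : ∀ x ∈ S, ∃ i < S.card, τ i = x := by
    intro x hx
    have : x ∈ Set.range o := by rw [S.range_orderEmbOfFin rfl]; exact hx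
    obtain ⟨i, hi⟩ := this
    exact ⟨i, i.2, by simp [τ, hi]⟩
  have hlast : τ S.card = t := by simp [τ]
  have hzero : τ 0 = 0 := by
    obtain ⟨i, -, hi⟩ := hex 0 (by simp [S])
    exact le_antisymm (hi ▸ hτ (Nat.zero_le i)) zero_le
  have htop : τ (S.card - 1) = s := by
    obtain ⟨i, hi, his⟩ := hex s (by simp [S])
    refine le_antisymm ?_ (his ▸ hτ (by omega))
    have h : S.card - 1 < S.card := by omega
    simp only [τ, dif_pos h]
    exact hSs _ (S.orderEmbOfFin_mem rfl _)
  have hpos : 0 < S.card := Finset.card_pos.2 ⟨0, by simp [S]⟩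
  have hri : ∀ j, ∃ i < S.card, τ i = r j := fun j => hex _ (by simp [S])
  choose k hk hkr using hri
  set n := S.card - 1
  have hn : S.card = n + 1 := by omega
  have hind := (HasIndepIncrements.nat hX hτ).indepFun_finset (Finset.range n) {n} (by simp)
    (fun i => (hm _).sub (hm _))
  have hψ : Measurable fun y : ({n} : Finset ℕ) → E => y ⟨n, Finset.mem_singleton_self n⟩ :=
    measurable_pi_apply _
  have hcomp := hind.comp (φ := fun (y : Finset.range n → E) (j : κ) =>
      ∑ i : Finset.range n, if (i : ℕ) < k j then y i else 0)
    (ψ := fun y => y ⟨n, Finset.mem_singleton_self n⟩)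
    (measurable_pi_lambda _ fun j => Finset.measurable_sum _ fun i _ => by
      split_ifs
      · exact measurable_pi_apply i
      · exact measurable_const)
    hψ
  refine hcomp.congr ?_ (.of_forall fun ω => ?_)
  · filter_upwards [h0] with ω hω
    funext j
    have hkn : k j ≤ n := by have := hk j; omega
    have hsum := Finset.sum_range_sub (fun i => X (τ i) ω) (k j)
    rw [hkr, hzero, hω] at hsum
    simp only [Function.comp]
    rw [Finset.sum_coe_sort (Finset.range n)
      (fun i => if i < k j then X (τ (i + 1)) ω - X (τ i) ω else 0), ← Finset.sum_filter]
    have : (Finset.range n).filter (· < k j) = Finset.range (k j) := by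
      ext i; simp; omega
    rw [this, hsum]; simp
  · simp [Function.comp, ← hn, hlast, htop]

end Independence

/-! ### Transfer along measure-preserving maps, and the copy on the product space. -/

section Copy

lemma tendstoInMeasure_of_measurePreserving {Ω Ω' ι E : Type*} [MeasurableSpace Ω]
    [MeasurableSpace Ω'] [NormedAddCommGroup E] {P : Measure Ω} {Q : Measure Ω'} {φ : Ω' → Ω}
    (hφ : MeasurePreserving φ Q P) {l : Filter ι} {f : ι → Ω → E} {f₀ : Ω → E}
    (hf : TendstoInMeasure P f l f₀) {f' : ι → Ω' → E} {f₀' : Ω' → E}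
    (h : ∀ i, f' i =ᵐ[Q] f i ∘ φ) (h₀ : f₀' =ᵐ[Q] f₀ ∘ φ) : TendstoInMeasure Q f' l f₀' := by
  refine TendstoInMeasure.congr (fun i => (h i).symm) h₀.symm fun ε hε => ?_
  refine tendsto_of_tendsto_of_tendsto_of_le_of_le tendsto_const_nhds (hf ε hε)
    (fun _ => zero_le) fun i => ?_
  rw [← hφ.map_eq]
  -- The inequality holds for arbitrary sets, so no measurability of `f` is needed.
  exact Measure.le_map_apply hφ.measurable.aemeasurable _

lemma tendstoInMeasure_sub {Ω ι : Type*} [MeasurableSpace Ω] {P : Measure Ω} {l : Filter ι}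
    {f f' : ι → Ω → ℝ} {g g' : Ω → ℝ} (hf : TendstoInMeasure P f l g)
    (hf' : TendstoInMeasure P f' l g') :
    TendstoInMeasure P (fun i ω => f i ω - f' i ω) l (fun ω => g ω - g' ω) := by
  rw [tendstoInMeasure_iff_dist] at *
  intro ε hε
  have h := (hf (ε / 2) (by positivity)).add (hf' (ε / 2) (by positivity))
  rw [add_zero] at h
  refine tendsto_of_tendsto_of_tendsto_of_le_of_le tendsto_const_nhds h (fun _ => zero_le)
    fun i => (measure_mono fun ω hω => ?_).trans (measure_union_le _ _)
  by_contra hcon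
  simp only [Set.mem_union, Set.mem_ofPred_eq, not_or, not_le] at hcon hω
  have := dist_sub_sub_le (f i ω) (f' i ω) (g ω) (g' ω)
  linarith [hcon.1, hcon.2]

lemma iIndepFun_comp_measurePreserving {Ω Ω' ι : Type*} {E : ι → Type*} [MeasurableSpace Ω]
    [MeasurableSpace Ω'] [∀ i, MeasurableSpace (E i)] {P : Measure Ω} {Q : Measure Ω'} {φ : Ω' → Ω}
    (hφ : MeasurePreserving φ Q P) {f : ∀ i, Ω → E i} (hm : ∀ i, Measurable (f i))
    (hf : iIndepFun f P) : iIndepFun (fun i => f i ∘ φ) Q := by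
  rw [iIndepFun_iff_measure_inter_preimage_eq_mul] at hf ⊢
  intro S s hs
  have h := hf S hs
  have hsets : ∀ i ∈ S, MeasurableSet (f i ⁻¹' s i) := fun i hi => hm i (hs i hi)
  rw [← hφ.measure_preimage (S.measurableSet_biInter hsets).nullMeasurableSet] at h
  simp only [Set.preimage_iInter] at h
  rw [Finset.prod_congr rfl fun i hi =>
    (hφ.measure_preimage (hsets i hi).nullMeasurableSet).symm] at h
  exact h

lemma IsLevyProcess.of_measurePreserving {Ω Ω' E : Type*} [MeasurableSpace Ω]
    [MeasurableSpace Ω'] [NormedAddCommGroup E] [MeasurableSpace E] [BorelSpace E]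
    [SecondCountableTopology E] {P : Measure Ω} {Q : Measure Ω'} {φ : Ω' → Ω}
    (hφ : MeasurePreserving φ Q P) {X : ℝ≥0 → Ω → E} (hX : IsLevyProcess P X)
    (hm : ∀ t, Measurable (X t)) {Y : ℝ≥0 → Ω' → E} (hY : ∀ t, Y t =ᵐ[Q] X t ∘ φ) :
    IsLevyProcess Q Y where
  aemeasurable t := ((hm t).comp hφ.measurable).aemeasurable.congr (hY t).symm
  zero := (hY 0).trans (hφ.quasiMeasurePreserving.ae_eq_comp hX.zero)
  indepIncrements n t ht := by
    refine (iIndepFun_comp_measurePreserving hφ (fun i => (hm _).sub (hm _))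
      (hX.indepIncrements n t ht)).congr fun i => ?_
    filter_upwards [hY (t i.succ), hY (t i.castSucc)] with ω h1 h2
    simp [h1, h2]
  stationaryIncrements s h := by
    have h1 : (fun ω => Y (s + h) ω - Y s ω) =ᵐ[Q] (fun ω => X (s + h) ω - X s ω) ∘ φ := by
      filter_upwards [hY (s + h), hY s] with ω h1 h2
      simp [h1, h2]
    have hs := hX.stationaryIncrements s h
    have hd : Measurable fun ω => X (s + h) ω - X s ω := (hm _).sub (hm _)
    refine ⟨(hd.comp hφ.measurable).aemeasurable.congr h1.symm,
      ((hm h).comp hφ.measurable).aemeasurable.congr (hY h).symm, ?_⟩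
    rw [Measure.map_congr h1, Measure.map_congr (hY h), ← Measure.map_map hd hφ.measurable,
      ← Measure.map_map (hm h) hφ.measurable, hφ.map_eq]
    exact hs.map_eq
  stochasticContinuity t := tendstoInMeasure_of_measurePreserving hφ (hX.stochasticContinuity t)
    hY (hY t)

variable {G H Ω : Type*} [MeasurableSpace Ω]
  [NormedAddCommGroup G] [InnerProductSpace ℝ G]
  [NormedAddCommGroup H] [InnerProductSpace ℝ H] {P : Measure Ω}

lemma coeFn_sub_apply (X Y : G →ₗ[ℝ] (Ω →ₘ[P] ℝ)) (g : G) :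
    ((X - Y) g : Ω → ℝ) =ᵐ[P] fun ω => (X g : Ω → ℝ) ω - (Y g : Ω → ℝ) ω :=
  AEEqFun.coeFn_sub (X g) (Y g)

lemma IsCylindricalRV.sub {X Y : G →ₗ[ℝ] (Ω →ₘ[P] ℝ)} (hX : IsCylindricalRV P X)
    (hY : IsCylindricalRV P Y) : IsCylindricalRV P (X - Y) := fun g =>
  (tendstoInMeasure_sub (hX g) (hY g)).congr (fun g' => (coeFn_sub_apply X Y g').symm)
    (coeFn_sub_apply X Y g).symm

variable [IsProbabilityMeasure P]

theorem IsCylindricalLevyProcess.productCopy {L : ℝ≥0 → G →ₗ[ℝ] (Ω →ₘ[P] ℝ)}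
    (hL : IsCylindricalLevyProcess P L) :
    IsCylindricalLevyProcess (P.prod P) (productCopy L) where
  isCylindricalRV t g := tendstoInMeasure_of_measurePreserving measurePreserving_snd
    (hL.isCylindricalRV t g) (productCopy_ae_eq L t) (productCopy_ae_eq L t g)
  isLevyProcess n g := by
    refine (hL.isLevyProcess n g).of_measurePreserving measurePreserving_snd
      (fun t => measurable_pi_lambda _ fun i => (L t (g i)).measurable) fun t => ?_
    filter_upwards [ae_all_iff.2 fun i => productCopy_ae_eq L t (g i)] with p hp
    funext i
    exact hp i

lemma productCopy_sub_ae_eq (L : ℝ≥0 → G →ₗ[ℝ] (Ω →ₘ[P] ℝ)) (s t : ℝ≥0) (g : G) :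
    ((CylLevy.productCopy L t - CylLevy.productCopy L s) g : Ω × Ω → ℝ) =ᵐ[P.prod P]
      fun p => ((L t - L s) g : Ω → ℝ) p.2 := by
  filter_upwards [coeFn_sub_apply (CylLevy.productCopy L t) (CylLevy.productCopy L s) g,
    productCopy_ae_eq L t g, productCopy_ae_eq L s g,
    measurePreserving_snd.quasiMeasurePreserving.ae_eq_comp (coeFn_sub_apply (L t) (L s) g)]
    with p h1 h2 h3 h4
  rw [h1, h2, h3]
  exact h4.symm

variable [CompleteSpace G] [CompleteSpace H] [SecondCountableTopology H] [MeasurableSpace H]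

/-- Radonified increments of the copy are the copies of the Radonified increments. -/
lemma isRadonification_productCopy_iff {L : ℝ≥0 → G →ₗ[ℝ] (Ω →ₘ[P] ℝ)} {s t : ℝ≥0}
    {Φ : G →L[ℝ] H} {R : Ω → H} (hR : IsRadonification P (L t - L s) Φ R) (R' : Ω × Ω → H) :
    IsRadonification (P.prod P) (CylLevy.productCopy L t - CylLevy.productCopy L s) Φ R' ↔
      Measurable R' ∧ R' =ᵐ[P.prod P] fun p => R p.2 := by
  have hcopy : ∀ h : H, ((CylLevy.productCopy L t - CylLevy.productCopy L s)
      (ContinuousLinearMap.adjoint Φ h) : Ω × Ω → ℝ) =ᵐ[P.prod P] fun p => inner ℝ (R p.2) h :=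
    fun h => (productCopy_sub_ae_eq L s t _).trans
      (measurePreserving_snd.quasiMeasurePreserving.ae_eq_comp (hR.ae_eq h))
  refine ⟨fun h => ⟨h.measurable, ?_⟩, fun h => ⟨h.1, fun x => ?_⟩⟩
  -- The exceptional null set depends on the test vector; testing on a countable dense set leaves a
  -- single null set.
  · have hall : ∀ᵐ p ∂(P.prod P), ∀ n, inner ℝ (R' p) (TopologicalSpace.denseSeq H n) =
        inner ℝ (R p.2) (TopologicalSpace.denseSeq H n) :=
      ae_all_iff.2 fun n => (h.ae_eq _).symm.trans (hcopy _)
    filter_upwards [hall] with p hp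
    exact (TopologicalSpace.denseRange_denseSeq H).eq_of_inner_left ℝ hp
  · filter_upwards [hcopy x, h.2] with p h1 h2
    rw [h1, h2]

end Copy

/-! ### Adaptedness of Radonified increments. -/

section Measurability

/-- `R` is the pointwise limit of its countable basis expansion. The σ-algebra on `α` is arbitrary,
which permits its use with each `naturalFiltration L t`. -/
lemma measurable_of_measurable_inner {α H : Type*} [MeasurableSpace α] [NormedAddCommGroup H]
    [InnerProductSpace ℝ H] [CompleteSpace H] [SecondCountableTopology H] [MeasurableSpace H]
    [BorelSpace H] {R : α → H} (h : ∀ x, Measurable fun a => (inner ℝ (R a) x : ℝ)) :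
    Measurable R := by
  obtain ⟨w, e, -⟩ := exists_hilbertBasis ℝ H
  have : Countable w := countable_of_orthonormal e.orthonormal
  refine measurable_of_tendsto_metrizable' atTop
    (f := fun (F : Finset w) a => ∑ i ∈ F, (inner ℝ (R a) (e i) : ℝ) • e i)
    (fun F => Finset.measurable_sum _ fun i _ => (h _).smul_const _)
    (tendsto_pi_nhds.2 fun a => ?_)
  have hs := e.hasSum_repr (R a)
  simp_rw [e.repr_apply_apply, real_inner_comm (R a)] at hs
  exact hs

variable {G H Ω : Type*} {mΩ : MeasurableSpace Ω}
  [NormedAddCommGroup G] [InnerProductSpace ℝ G]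
  [NormedAddCommGroup H] [InnerProductSpace ℝ H] {P : Measure Ω}

lemma measurable_naturalFiltration (L : ℝ≥0 → G →ₗ[ℝ] (Ω →ₘ[P] ℝ)) {s t : ℝ≥0} (hst : s ≤ t)
    {g : G} {f : Ω → ℝ} (hf : Measurable f) (hfg : f =ᵐ[P] (L s g : Ω → ℝ)) :
    Measurable[naturalFiltration L t] f := by
  rw [measurable_iff_comap_le]
  exact le_iSup_of_le s <| le_iSup_of_le hst <| le_iSup_of_le g <| le_iSup_of_le f <|
    le_iSup_of_le hf <| le_iSup_of_le hfg le_rfl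

/-- `f + L s g` represents `L t g`. Since all measurable representatives generate the filtration,
measurability is exact and not merely up to null sets. -/
lemma measurable_naturalFiltration_sub (L : ℝ≥0 → G →ₗ[ℝ] (Ω →ₘ[P] ℝ)) {s t : ℝ≥0} (hst : s ≤ t)
    {g : G} {f : Ω → ℝ} (hf : Measurable f) (hfg : f =ᵐ[P] ((L t - L s) g : Ω → ℝ)) :
    Measurable[naturalFiltration L t] f := by
  have h1 := measurable_naturalFiltration L hst (L s g).measurable (ae_eq_refl _)
  have h2 : Measurable[naturalFiltration L t] (f + (L s g : Ω → ℝ)) := by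
    refine measurable_naturalFiltration L le_rfl (g := g) (hf.add (L s g).measurable) ?_
    filter_upwards [hfg, coeFn_sub_apply (L t) (L s) g] with ω h1 h2
    rw [Pi.add_apply, h1, h2, sub_add_cancel]
  simpa using h2.sub h1

lemma IsRadonification.measurable_naturalFiltration [CompleteSpace G] [CompleteSpace H]
    [SecondCountableTopology H] [MeasurableSpace H] [BorelSpace H]
    {L : ℝ≥0 → G →ₗ[ℝ] (Ω →ₘ[P] ℝ)} {s t : ℝ≥0} (hst : s ≤ t) {Φ : G →L[ℝ] H} {R : Ω → H}
    (hR : IsRadonification P (L t - L s) Φ R) : Measurable[naturalFiltration L t] R :=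
  @measurable_of_measurable_inner Ω H (naturalFiltration L t) _ _ _ _ _ _ R fun x =>
    measurable_naturalFiltration_sub L hst (hR.measurable.inner measurable_const) (hR.ae_eq x).symm

end Measurability

/-! ### Independence of Radonified increments from each other and from the past. -/

section Increments

variable {G H Ω : Type*} [mΩ : MeasurableSpace Ω]
  [NormedAddCommGroup G] [InnerProductSpace ℝ G]
  [NormedAddCommGroup H] [InnerProductSpace ℝ H] {P : Measure Ω}

/-- Independent increments of the finite-dimensional projections, over an arbitrary index type. -/
lemma IsCylindricalLevyProcess.hasIndepIncrements {L : ℝ≥0 → G →ₗ[ℝ] (Ω →ₘ[P] ℝ)}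
    (hL : IsCylindricalLevyProcess P L) {κ : Type*} [Finite κ] (g : κ → G) :
    HasIndepIncrements (fun t ω (i : κ) => (L t (g i) : Ω → ℝ) ω) P := by
  have := Fintype.ofFinite κ
  let e := Fintype.equivFin κ
  have h := (hL.isLevyProcess _ (g ∘ e.symm)).indepIncrements
  intro n t ht
  have h' := (h n t ht).comp (fun _ (y : Fin (Fintype.card κ) → ℝ) (i : κ) => y (e i))
    (fun _ => measurable_pi_lambda _ fun i => measurable_pi_apply _)
  convert h' using 2 with i
  funext ω j
  simp

lemma IsCylindricalLevyProcess.ae_eq_zero {L : ℝ≥0 → G →ₗ[ℝ] (Ω →ₘ[P] ℝ)}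
    (hL : IsCylindricalLevyProcess P L) (g : G) : (L 0 g : Ω → ℝ) =ᵐ[P] 0 := by
  filter_upwards [(hL.isLevyProcess 1 fun _ => g).zero] with ω hω
  exact congrFun hω 0

variable [CompleteSpace G] [CompleteSpace H] [MeasurableSpace H]

lemma sum_mul_inner_ae_eq {M : ℕ} {X : G →ₗ[ℝ] (Ω →ₘ[P] ℝ)} {Φ : Fin M → G →L[ℝ] H}
    {R : Fin M → Ω → H} (hR : ∀ k, IsRadonification P X (Φ k) (R k)) (c : Fin M → ℝ)
    (h : Fin M → H) :
    (X (∑ k, c k • ContinuousLinearMap.adjoint (Φ k) (h k)) : Ω → ℝ) =ᵐ[P]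
      fun ω => ∑ k, c k * inner ℝ (R k ω) (h k) := by
  filter_upwards [coeFn_map_sum_smul X c (fun k => ContinuousLinearMap.adjoint (Φ k) (h k))
    Finset.univ, ae_all_iff.2 fun k => (hR k).ae_eq (h k)] with ω h1 h2
  rw [h1]
  exact Finset.sum_congr rfl fun k _ => by rw [h2]

variable [BorelSpace H] [SecondCountableTopology H] [IsProbabilityMeasure P]

/-- Radonified increments over consecutive intervals, evaluated at a fixed simple operator, are
independent. -/
lemma IsCylindricalLevyProcess.iIndepFun_sum_smul {L : ℝ≥0 → G →ₗ[ℝ] (Ω →ₘ[P] ℝ)}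
    (hL : IsCylindricalLevyProcess P L) {N : ℕ} {t : Fin (N + 1) → ℝ≥0} (ht : Monotone t)
    {M : Fin N → ℕ} {Φ : (n : Fin N) → Fin (M n) → G →L[ℝ] H} {R : (n : Fin N) → Fin (M n) → Ω → H}
    (hR : ∀ n k, IsRadonification P (L (t n.succ) - L (t n.castSucc)) (Φ n k) (R n k))
    (c : (n : Fin N) → Fin (M n) → ℝ) :
    iIndepFun (fun n ω => ∑ k, c n k • R n k ω) P := by
  refine iIndepFun_of_inner
    (fun n => Finset.measurable_sum _ fun k _ => (hR n k).measurable.const_smul _) fun a => ?_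
  -- The projection of the `n`-th sum on `a n` is the increment of `L` at `g n`. Hence it is the
  -- `n`-th coordinate of the `n`-th increment of the vector process `(L g₁, …, L g_N)`.
  let g : Fin N → G := fun n => ∑ k, c n k • ContinuousLinearMap.adjoint (Φ n k) (a n)
  have h := (hL.hasIndepIncrements g N t ht).comp (fun n (y : Fin N → ℝ) => y n)
    (fun n => measurable_pi_apply n)
  refine h.congr fun n => ?_
  filter_upwards [sum_mul_inner_ae_eq (hR n) (c n) fun _ => a n,
    coeFn_sub_apply (L (t n.succ)) (L (t n.castSucc)) (g n)] with ω h1 h2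
  simp only [Function.comp, Pi.sub_apply, sum_inner, real_inner_smul_left]
  rw [← h1, ← h2]

/-- Radonified increments are independent of the past of the cylindrical process. -/
lemma IsCylindricalLevyProcess.indep_naturalFiltration {L : ℝ≥0 → G →ₗ[ℝ] (Ω →ₘ[P] ℝ)}
    (hL : IsCylindricalLevyProcess P L) {s t : ℝ≥0} (hst : s ≤ t) {M : ℕ}
    {Φ : Fin M → G →L[ℝ] H} {R : Fin M → Ω → H}
    (hR : ∀ k, IsRadonification P (L t - L s) (Φ k) (R k)) :
    Indep (naturalFiltration L s) (MeasurableSpace.comap (fun ω k => R k ω) inferInstance) P := by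
  classical
  -- All generators of the past σ-algebra. Finite subfamilies generate a directed family of
  -- σ-algebras, so independence need only be checked for these.
  let I := {x : ℝ≥0 × G × (Ω → ℝ) //
    x.1 ≤ s ∧ Measurable x.2.2 ∧ x.2.2 =ᵐ[P] (L x.1 x.2.1 : Ω → ℝ)}
  let Z : (u : Finset I) → Ω → u → ℝ := fun u ω i => i.1.1.2.2 ω
  have hZ : ∀ u, Measurable (Z u) := fun u => measurable_pi_lambda _ fun i => i.1.2.2.1
  have hRm : Measurable fun ω k => R k ω := measurable_pi_lambda _ fun k => (hR k).measurable
  have hle : (naturalFiltration L s : MeasurableSpace Ω) ≤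
      ⨆ u : Finset I, MeasurableSpace.comap (Z u) inferInstance := by
    refine iSup_le fun r => iSup_le fun hr => iSup_le fun g => iSup_le fun f => iSup_le fun hf =>
      iSup_le fun hfg => ?_
    let i : I := ⟨(r, g, f), hr, hf, hfg⟩
    refine le_trans ?_ (le_iSup _ ({i} : Finset I))
    rw [← measurable_iff_comap_le]
    exact (measurable_pi_apply (⟨i, Finset.mem_singleton_self i⟩ : ({i} : Finset I))).comp
      (comap_measurable (Z {i}))
  refine indep_of_indep_of_le_left (indep_iSup_of_directed_le (fun u => ?_)
    (fun u => (hZ u).comap_le) hRm.comap_le ?_) hle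
  · change IndepFun (Z u) (fun ω k => R k ω) P
    have hind : IndepFun (fun ω => WithLp.toLp 2 (Z u ω))
        (fun ω => WithLp.toLp 2 fun k => R k ω) P := by
      refine indepFun_of_inner ((PiLp.continuous_toLp 2 _).measurable.comp (hZ u))
        ((PiLp.continuous_toLp 2 _).measurable.comp hRm) fun a b => ?_
      let g₀ : G := ∑ k, (1 : ℝ) • ContinuousLinearMap.adjoint (Φ k) (b k)
      -- One vector process carries both sides: the coordinates `some i` give the past values, and
      -- `none` the projected future increment.
      let g : Option u → G := fun o => o.elim g₀ fun i => i.1.1.2.1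
      have h0 : (fun ω (o : Option u) => (L 0 (g o) : Ω → ℝ) ω) =ᵐ[P] 0 := by
        filter_upwards [ae_all_iff.2 fun o => hL.ae_eq_zero (g o)] with ω hω
        funext o
        exact hω o
      have h := HasIndepIncrements.indepFun_finite_past (hL.hasIndepIncrements g)
        (fun r => measurable_pi_lambda _ fun o => (L r (g o)).measurable) h0
        (fun i : u => i.1.1.1) (fun i => i.1.2.1) hst
      have hψ : Measurable fun y : Option u → ℝ => y none := measurable_pi_apply _
      have h' := h.comp (φ := fun (y : u → Option u → ℝ) => ∑ i, a i * y i (some i))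
        (ψ := fun y => y none) (by fun_prop) hψ
      refine h'.congr ?_ ?_
      · filter_upwards [ae_all_iff.2 fun i : u => i.1.2.2.2] with ω hω
        simp [Function.comp, PiLp.inner_apply, Z, hω, g]
      · filter_upwards [sum_mul_inner_ae_eq hR (fun _ => 1) b, coeFn_sub_apply (L t) (L s) g₀]
          with ω h1 h2
        simp only [Function.comp, Pi.sub_apply, PiLp.inner_apply, g, Option.elim]
        rw [← h2, h1]
        simp
    exact hind.comp (PiLp.continuous_ofLp 2 _).measurable (PiLp.continuous_ofLp 2 _).measurable
  · refine Monotone.directed_le fun u v huv => ?_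
    rw [← measurable_iff_comap_le]
    exact (measurable_pi_lambda (fun (y : v → ℝ) (i : u) => y ⟨i.1, huv i.2⟩) fun i =>
      measurable_pi_apply _).comp (comap_measurable (Z v))

end Increments

/-! ### Conditional laws on the product space. -/

section ConditionalLaw

/-- `condDistrib` is constructed from the joint law alone, so the kernels agree everywhere and not
just almost everywhere. -/
lemma condDistrib_congr_of_map_eq {α β H : Type*} [MeasurableSpace α] [MeasurableSpace β]
    [MeasurableSpace H] [StandardBorelSpace H] [Nonempty H] {μ : Measure α} [IsFiniteMeasure μ]
    {U : α → β} {X Y : α → H} (h : μ.map (fun a => (U a, X a)) = μ.map (fun a => (U a, Y a))) :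
    condDistrib X U μ = condDistrib Y U μ := by
  rw [condDistrib_def, condDistrib_def]
  congr 1

lemma map_prodMk_eq_of_indepFun {α β E H : Type*} [MeasurableSpace α] [MeasurableSpace β]
    [MeasurableSpace E] [MeasurableSpace H] {μ : Measure α} [IsProbabilityMeasure μ]
    {U : α → β} {V W : α → E} (hU : Measurable U) (hV : Measurable V) (hW : Measurable W)
    (hUV : IndepFun U V μ) (hUW : IndepFun U W μ) (hVW : μ.map V = μ.map W)
    {S : β × E → H} (hS : Measurable S) :
    μ.map (fun a => (U a, S (U a, V a))) = μ.map (fun a => (U a, S (U a, W a))) := by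
  have h : μ.map (fun a => (U a, V a)) = μ.map (fun a => (U a, W a)) := by
    rw [(indepFun_iff_map_prod_eq_prod_map_map hU.aemeasurable hV.aemeasurable).1 hUV,
      (indepFun_iff_map_prod_eq_prod_map_map hU.aemeasurable hW.aemeasurable).1 hUW, hVW]
  have h' := congrArg (Measure.map fun p : β × E => (p.1, S p)) h
  rwa [Measure.map_map (by fun_prop) (by fun_prop), Measure.map_map (by fun_prop) (by fun_prop)]
    at h'

/-- On rectangles, `V` interacts only with the copy of `U` in the same coordinate; the other copy is
independent of both by the product structure. -/
lemma indepFun_prodMap_fst {Ω β E : Type*} [MeasurableSpace Ω] [MeasurableSpace β]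
    [MeasurableSpace E] {P : Measure Ω} [IsProbabilityMeasure P] {U : Ω → β} {V : Ω → E}
    (hU : Measurable U) (hV : Measurable V) (h : IndepFun U V P) :
    IndepFun (fun p : Ω × Ω => (U p.1, U p.2)) (fun p => V p.1) (P.prod P) := by
  have := Measure.isProbabilityMeasure_map (μ := P) hU.aemeasurable
  have := Measure.isProbabilityMeasure_map (μ := P) hV.aemeasurable
  rw [indepFun_iff_map_prod_eq_prod_map_map (by fun_prop) (by fun_prop)]
  refine Measure.ext_prod₃' fun {s t u} hs ht hu => ?_
  rw [Measure.prod_prod, Measure.map_apply (by fun_prop) ((hs.prod ht).prod hu),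
    Measure.map_apply (by fun_prop) (hs.prod ht), Measure.map_apply (by fun_prop) hu]
  have e1 : (fun p : Ω × Ω => ((U p.1, U p.2), V p.1)) ⁻¹' ((s ×ˢ t) ×ˢ u) =
      (U ⁻¹' s ∩ V ⁻¹' u) ×ˢ (U ⁻¹' t) := by
    ext p; simp; tauto
  have e2 : (fun p : Ω × Ω => (U p.1, U p.2)) ⁻¹' (s ×ˢ t) = (U ⁻¹' s) ×ˢ (U ⁻¹' t) := rfl
  have e3 : (fun p : Ω × Ω => V p.1) ⁻¹' u = (V ⁻¹' u) ×ˢ Set.univ := by ext p; simp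
  rw [e1, e2, e3, Measure.prod_prod, Measure.prod_prod, Measure.prod_prod, measure_univ, mul_one,
    h.measure_inter_preimage_eq_mul _ _ hs hu]
  ring

lemma indepFun_prodMap_snd {Ω β E : Type*} [MeasurableSpace Ω] [MeasurableSpace β]
    [MeasurableSpace E] {P : Measure Ω} [IsProbabilityMeasure P] {U : Ω → β} {V : Ω → E}
    (hU : Measurable U) (hV : Measurable V) (h : IndepFun U V P) :
    IndepFun (fun p : Ω × Ω => (U p.1, U p.2)) (fun p => V p.2) (P.prod P) := by
  rw [indepFun_iff_map_prod_eq_prod_map_map (by fun_prop) (by fun_prop)]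
  refine Measure.ext_prod₃' fun {s t u} hs ht hu => ?_
  rw [Measure.prod_prod, Measure.map_apply (by fun_prop) ((hs.prod ht).prod hu),
    Measure.map_apply (by fun_prop) (hs.prod ht), Measure.map_apply (by fun_prop) hu]
  have e1 : (fun p : Ω × Ω => ((U p.1, U p.2), V p.2)) ⁻¹' ((s ×ˢ t) ×ˢ u) =
      (U ⁻¹' s) ×ˢ (U ⁻¹' t ∩ V ⁻¹' u) := by
    ext p; simp; tauto
  have e2 : (fun p : Ω × Ω => (U p.1, U p.2)) ⁻¹' (s ×ˢ t) = (U ⁻¹' s) ×ˢ (U ⁻¹' t) := rfl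
  have e3 : (fun p : Ω × Ω => V p.2) ⁻¹' u = Set.univ ×ˢ (V ⁻¹' u) := by ext p; simp
  rw [e1, e2, e3, Measure.prod_prod, Measure.prod_prod, Measure.prod_prod, measure_univ, one_mul,
    h.measure_inter_preimage_eq_mul _ _ ht hu]
  ring

/-- If `U` and `V` are independent, then a function of `U` and `V` has the same conditional law
given two independent copies of `U`, whether `V` is evaluated at the first or at the second copy. -/
lemma condDistrib_prodMap_eq {Ω β E H : Type*} [MeasurableSpace Ω] [MeasurableSpace β]
    [MeasurableSpace E] [MeasurableSpace H] [StandardBorelSpace H] [Nonempty H] {P : Measure Ω}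
    [IsProbabilityMeasure P] {U : Ω → β} {V : Ω → E} (hU : Measurable U) (hV : Measurable V)
    (h : IndepFun U V P) {S : β × E → H} (hS : Measurable S) :
    condDistrib (fun p : Ω × Ω => S (U p.1, V p.1)) (fun p => (U p.1, U p.2)) (P.prod P) =
      condDistrib (fun p : Ω × Ω => S (U p.1, V p.2)) (fun p => (U p.1, U p.2)) (P.prod P) := by
  refine condDistrib_congr_of_map_eq (map_prodMk_eq_of_indepFun
    (U := fun p : Ω × Ω => (U p.1, U p.2)) (V := fun p => V p.1) (W := fun p => V p.2)
    (S := fun q => S (q.1.1, q.2)) (by fun_prop) (by fun_prop) (by fun_prop)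
    (indepFun_prodMap_fst hU hV h) (indepFun_prodMap_snd hU hV h) ?_ (by fun_prop))
  have h1 : (fun p : Ω × Ω => V p.1) = V ∘ Prod.fst := rfl
  have h2 : (fun p : Ω × Ω => V p.2) = V ∘ Prod.snd := rfl
  rw [h1, h2, ← Measure.map_map hV measurable_fst, ← Measure.map_map hV measurable_snd,
    measurePreserving_fst.map_eq, measurePreserving_snd.map_eq]

/-- Conditioning on a σ-algebra is conditioning on the identity map into `(Ω, m)`, so `U = id`
reduces this to `condDistrib_prodMap_eq`. -/
lemma condLaw_eq_of_indep {Ω E H : Type*} {m mΩ : MeasurableSpace Ω} [MeasurableSpace E]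
    [MeasurableSpace H] [StandardBorelSpace H] [Nonempty H] {P : Measure Ω} [IsProbabilityMeasure P]
    (hm : m ≤ mΩ) {V : Ω → E} (hV : Measurable V)
    (h : Indep m (MeasurableSpace.comap V inferInstance) P) {S : Ω × E → H}
    (hS : Measurable[m.prod inferInstance] S) :
    condLaw (P.prod P) (m.prod m) (fun p => S (p.1, V p.1)) =
      condLaw (P.prod P) (m.prod m) (fun p => S (p.1, V p.2)) := by
  have hi : @IndepFun Ω Ω E mΩ m _ id V P := by
    refine (@IndepFun_iff_Indep Ω Ω E mΩ m _ id V P).2 ?_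
    rwa [MeasurableSpace.comap_id]
  exact @condDistrib_prodMap_eq Ω Ω E H mΩ m _ _ _ _ P _ id V (fun s hs => hm s hs) hV hi S hS

end ConditionalLaw

/-! ### The decoupled tangent sequence. -/

section Tangent

/-- The function `(ω, r) ↦ ∑ₖ 1_{Aₖ}(ω) rₖ` is measurable. -/
lemma measurable_sum_indicator {α Ω H : Type*} [MeasurableSpace α] [MeasurableSpace Ω]
    [NormedAddCommGroup H] [MeasurableSpace H] [BorelSpace H] [SecondCountableTopology H] {M : ℕ}
    {A : Fin M → Set Ω} (hA : ∀ k, MeasurableSet (A k)) {f : α → Ω} (hf : Measurable f)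
    {R : Fin M → α → H} (hR : ∀ k, Measurable (R k)) :
    Measurable fun a => ∑ k, (A k).indicator (fun _ => R k a) (f a) :=
  Finset.measurable_sum _ fun k _ => (hR k).indicator (hf (hA k))

theorem IsCylindricalLevyProcess.isDecoupledTangent {G H Ω : Type*} [mΩ : MeasurableSpace Ω]
    [NormedAddCommGroup G] [InnerProductSpace ℝ G] [CompleteSpace G]
    [NormedAddCommGroup H] [InnerProductSpace ℝ H] [CompleteSpace H] [SecondCountableTopology H]
    [MeasurableSpace H] [BorelSpace H] {P : Measure Ω} [IsProbabilityMeasure P]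
    {L : ℝ≥0 → G →ₗ[ℝ] (Ω →ₘ[P] ℝ)} (hL : IsCylindricalLevyProcess P L)
    {N : ℕ} {t : Fin (N + 1) → ℝ≥0} (ht : Monotone t)
    {M : Fin N → ℕ} {Φ : (n : Fin N) → Fin (M n) → G →L[ℝ] H}
    {A : (n : Fin N) → Fin (M n) → Set Ω}
    (hA : ∀ n k, MeasurableSet[naturalFiltration L (t n.castSucc)] (A n k))
    {R : (n : Fin N) → Fin (M n) → Ω → H}
    (hR : ∀ n k, IsRadonification P (L (t n.succ) - L (t n.castSucc)) (Φ n k) (R n k)) :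
    IsDecoupledTangent P P (sampled (naturalFiltration L) t ht)
      (sampled (naturalFiltration L) t ht)
      (fun n ω => simpleIncrement (A n) (R n) ω ω)
      (fun n p => simpleIncrement (A n) (R n) p.1 p.2) := by
  have hle : ∀ n : Fin N, t n.castSucc ≤ t n.succ := fun n => ht n.castSucc_le_succ
  have hA' : ∀ n k, MeasurableSet[naturalFiltration L (t n.succ)] (A n k) := fun n k =>
    (naturalFiltration L).mono (hle n) _ (hA n k)
  have hR' : ∀ n k, Measurable[naturalFiltration L (t n.succ)] (R n k) := fun n k =>
    (hR n k).measurable_naturalFiltration (hle n)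
  refine ⟨fun n => ?_, fun n => ?_, fun ω => ?_, fun n => ?_⟩
  · exact @measurable_sum_indicator Ω Ω H (naturalFiltration L (t n.succ))
      (naturalFiltration L (t n.succ)) _ _ _ _ _ _ (hA' n) id (fun s hs => hs) _ (hR' n)
  · let m : MeasurableSpace Ω := naturalFiltration L (t n.succ)
    exact @measurable_sum_indicator (Ω × Ω) Ω H (m.prod m) m _ _ _ _ _ _ (hA' n) Prod.fst
      (@measurable_fst Ω Ω m m) _ fun k => (hR' n k).comp (@measurable_snd Ω Ω m m)
  -- With `ω` frozen the indicators become deterministic coefficients `0` or `1`.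
  · have h := hL.iIndepFun_sum_smul ht hR fun n k => (A n k).indicator (fun _ => (1 : ℝ)) ω
    refine h.congr fun n => .of_forall fun ω' => Finset.sum_congr rfl fun k _ => ?_
    by_cases hω : ω ∈ A n k <;> simp [hω]
  · have hm := (naturalFiltration L).le (t n.castSucc)
    -- This is `S(ω, r) = ∑ₖ 1_{Aₖ}(ω) rₖ`; its `ω`-dependence is measurable for the past σ-algebra
    -- at `t n.castSucc`, as the conditioning requires.
    have hS := @measurable_sum_indicator (Ω × (Fin (M n) → H)) Ω H
      ((naturalFiltration L (t n.castSucc)).prod inferInstance) (naturalFiltration L (t n.castSucc))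
      _ _ _ _ _ _ (hA n) Prod.fst (@measurable_fst _ _ (naturalFiltration L (t n.castSucc)) _)
      (fun k p => p.2 k) fun k => (measurable_pi_apply k).comp
        (@measurable_snd _ _ (naturalFiltration L (t n.castSucc)) _)
    have h := condLaw_eq_of_indep hm
      (measurable_pi_lambda (fun ω k => R n k ω) fun k => (hR n k).measurable)
      (hL.indep_naturalFiltration (hle n) (hR n)) hS
    exact .of_forall fun p => congrArg (fun κ => κ p) h

end Tangent

end CylLevy

theorem proposition5p3 {G H Ω : Type*} [MeasurableSpace Ω]
    [NormedAddCommGroup G] [InnerProductSpace ℝ G] [CompleteSpace G] [SecondCountableTopology G]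
    [NormedAddCommGroup H] [InnerProductSpace ℝ H] [CompleteSpace H] [SecondCountableTopology H]
    [MeasurableSpace H] [BorelSpace H]
    (P : Measure Ω) [IsProbabilityMeasure P]
    (L : ℝ≥0 → G →ₗ[ℝ] (Ω →ₘ[P] ℝ)) (hL : CylLevy.IsCylindricalLevyProcess P L) :
    -- the copy is a cylindrical Lévy process
    CylLevy.IsCylindricalLevyProcess (P.prod P) (CylLevy.productCopy L) ∧
    ∀ (T : ℝ≥0) (N : ℕ) (t : Fin (N + 1) → ℝ≥0) (ht : Monotone t),
      t 0 = 0 → t (Fin.last N) = T →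
      ∀ (M : Fin N → ℕ) (Φ : (n : Fin N) → Fin (M n) → G →L[ℝ] H)
        (A : (n : Fin N) → Fin (M n) → Set Ω),
      (∀ n k, CylLevy.IsHilbertSchmidt (Φ n k)) →
      (∀ n k, MeasurableSet[CylLevy.naturalFiltration L (t n.castSucc)] (A n k)) →
      -- the Radonified increments of `L` exist
      (∀ n k, ∃ R : Ω → H,
        CylLevy.IsRadonification P (L (t n.succ) - L (t n.castSucc)) (Φ n k) R) ∧
      ∀ R : (n : Fin N) → Fin (M n) → Ω → H,
        (∀ n k, CylLevy.IsRadonification P (L (t n.succ) - L (t n.castSucc)) (Φ n k) (R n k)) →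
        -- their copies are, up to null sets, the Radonified increments of `L̃`
        (∀ n k (R' : Ω × Ω → H), CylLevy.IsRadonification (P.prod P)
            (CylLevy.productCopy L (t n.succ) - CylLevy.productCopy L (t n.castSucc)) (Φ n k) R' ↔
          Measurable R' ∧ R' =ᵐ[P.prod P] fun p => R n k p.2) ∧
        CylLevy.IsDecoupledTangent P P
          (CylLevy.sampled (CylLevy.naturalFiltration L) t ht)
          (CylLevy.sampled (CylLevy.naturalFiltration L) t ht)
          (fun n ω => CylLevy.simpleIncrement (A n) (R n) ω ω)
          (fun n p => CylLevy.simpleIncrement (A n) (R n) p.1 p.2) := by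

  refine ⟨hL.productCopy, fun T N t ht _ _ M Φ A hΦ hA => ⟨fun n k => ?_, fun R hR => ⟨?_, ?_⟩⟩⟩
  · exact ((hL.isCylindricalRV _).sub (hL.isCylindricalRV _)).exists_isRadonification (hΦ n k)
  · exact fun n k => CylLevy.isRadonification_productCopy_iff (hR n k)
  · exact hL.isDecoupledTangent ht hA hR
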